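/- Let $\Bbbk$ be a field, let $d\in\mathbb{N}=\{0,1,2,\dots\}$, and let $\mathcal{C}$ be an lfp category over $\Bbbk$: a $\Bbbk$-linear abelian category in which every object has finite length, all $\mathrm{Hom}$-spaces are finite dimensional over $\Bbbk$, and there are enough projective and enough injective objects. Definitions. $\mathcal{C}$ is $d$-$\mathcal{IG}$ if every projective object has injective dimension at most $d$, and $d$-$\mathcal{GI}$ if every injective object has projective dimension at most $d$; it is $d$-Iwanaga–Gorenstein if it is both. A totally acyclic complex is an exact complex $P_\bullet=(\cdots\to P_1\to P_0\to P_{-1}\to\cdots)$ of projective objects such that $\mathrm{Hom}_{\mathcal{C}}(P_\bullet,Q)$ is exact for every projective object $Q$. An object is Gorenstein projective if it is isomorphic to $\mathrm{coker}(P_{i+1}\to P_i)$ for some totally acyclic complex $P_\bullet$ and some $i\in\mathbb{Z}$. The G-dimension $\mathrm{Gd}_{\mathcal{C}}X\in\mathbb{N}\cup\{\infty\}$ of an object $X$ is the minimal $n$ for which there is an exact sequence $0\to G_n\to\cdots\to G_0\to X\to 0$ with all $G_i$ Gorenstein projective ($\infty$ if there is none). $\mathcal{C}$ is $d$-Gorenstein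 if $\mathrm{Gd}_{\mathcal{C}}X\le d$ for every object $X$. The finitistic dimension $\mathrm{fin.d}\,\mathcal{C}$ is the supremum of all finite projective dimensions of objects of $\mathcal{C}$. Theorem. The following are equivalent: (i) $\mathcal{C}$ is $d$-Iwanaga–Gorenstein; (ii) $\mathcal{C}$ is $d$-Gorenstein. Moreover, if $\mathcal{C}$ is $d$-Gorenstein, then $\mathrm{fin.d}\,\mathcal{C}\le d$. -/

import Mathlib

open CategoryTheory CategoryTheory.Limits

namespace GorensteinCat

universe w v u

section FiniteLength

variable {C : Type u} [Category.{v} C] [Abelian C]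

/-- An object `X` of an abelian category has finite length if it has a composition series
`0 = X₀ ⊂ X₁ ⊂ ⋯ ⊂ Xₙ = X` with all quotients `Xᵢ₊₁ / Xᵢ` simple. -/
inductive HasFiniteLength : C → Prop
  | of_isZero {X : C} (hX : IsZero X) : HasFiniteLength X
  | of_simple_cokernel {X Y : C} (i : Y ⟶ X) [Mono i] [Simple (cokernel i)]
      (hY : HasFiniteLength Y) : HasFiniteLength X

end FiniteLength

/-- A `k`-linear abelian category is lfp if all objects have finite length, all morphism spaces are
finite dimensional over `k`, and there are enough projective and enough injective objects. -/
structure IsLFP (k : Type w) [Field k] (C : Type u) [Category.{v} C] [Abelian C]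
    [Linear k C] : Prop where
  hasFiniteLength (X : C) : HasFiniteLength X
  finiteDimensional_hom (X Y : C) : FiniteDimensional k (X ⟶ Y)
  enoughProjectives : EnoughProjectives C
  enoughInjectives : EnoughInjectives C

section GorensteinProjective

variable {C : Type u} [Category.{v} C] [Abelian C]

/-- A totally acyclic complex `⋯ ⟶ P₁ ⟶ P₀ ⟶ P₋₁ ⟶ ⋯`: an exact complex of projective objects
such that `Hom(P, Q)` is an exact complex of abelian groups for every projective object `Q`. -/
structure IsTotallyAcyclic (P : ChainComplex C ℤ) : Prop where
  projective (i : ℤ) : Projective (P.X i)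
  acyclic : P.Acyclic
  hom_exact (Q : C) (_ : Projective Q) (i : ℤ) (f : P.X i ⟶ Q) (_ : P.d (i + 1) i ≫ f = 0) :
    ∃ g : P.X (i - 1) ⟶ Q, P.d i (i - 1) ≫ g = f

/-- `X` is Gorenstein projective if it is isomorphic to a syzygy
`Ωⁱ(P) = coker (P_{i+1} ⟶ P_i)` of a totally acyclic complex `P`. -/
def IsGorensteinProjective (X : C) : Prop :=
  ∃ (P : ChainComplex C ℤ) (i : ℤ),
    IsTotallyAcyclic P ∧ Nonempty (X ≅ cokernel (P.d (i + 1) i))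

/-- `X` has a resolution `0 ⟶ Gₙ ⟶ ⋯ ⟶ G₀ ⟶ X ⟶ 0` by Gorenstein projective objects. -/
def HasGPResolutionOfLengthLE (X : C) (n : ℕ) : Prop :=
  ∃ G : ChainComplex C ℕ,
    (∀ i, IsGorensteinProjective (G.X i)) ∧
    (∀ i, 0 < i → G.ExactAt i) ∧
    Nonempty (G.homology 0 ≅ X) ∧
    ∀ i, n < i → IsZero (G.X i)

/-- The G-dimension of `X`: the minimal length of a resolution of `X` by Gorenstein projective
objects, and `⊤` if there is no such resolution of finite length. -/
noncomputable def gDimension (X : C) : ℕ∞ :=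
  ⨅ (n : ℕ) (_ : HasGPResolutionOfLengthLE X n), (n : ℕ∞)

end GorensteinProjective

section Categories

variable (C : Type u) [Category.{v} C] [Abelian C]

/-- The injective dimensions of the projective objects are bounded by `d`. -/
def IsIG (d : ℕ) : Prop :=
  ∀ P : C, Projective P → injectiveDimension P ≤ d

/-- The projective dimensions of the injective objects are bounded by `d`. -/
def IsGI (d : ℕ) : Prop :=
  ∀ I : C, Injective I → projectiveDimension I ≤ d

/-- `d`-Iwanaga–Gorenstein categories. -/
def IsIwanagaGorenstein (d : ℕ) : Prop :=
  IsIG C d ∧ IsGI C d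

/-- `d`-Gorenstein categories: every object has G-dimension at most `d`. -/
def IsGorenstein (d : ℕ) : Prop :=
  ∀ X : C, gDimension X ≤ d

/-- The finitistic dimension: the supremum of all finite projective dimensions of objects. The
projective dimension of a zero object, which is `⊥` in Mathlib, is counted as `0`. -/
noncomputable def finitisticDimension : ℕ∞ :=
  ⨆ (X : C) (_ : projectiveDimension X < ⊤), (projectiveDimension X).unbotD 0

end Categories

end GorensteinCat

/-!
The argument works in any abelian category with enough projective and enough injective objects.

Gorenstein projectivity is used through a coinduction principle, `isGorensteinProjective_of_class`:
a class of objects `M` with `Extⁱ(M, R) = 0` for all `i > 0` and all projective `R`, in which every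
object is a syzygy of, and has as a syzygy, an object of the class, consists of Gorenstein
projective objects, because the short exact sequences can be spliced to a totally acyclic complex.
Conversely the Gorenstein projective objects form such a class. Together with the horseshoe lemma
and its dual, this also shows that they are closed under extensions.

Suppose that the category is `d`-Iwanaga–Gorenstein. The bound on the injective dimensions of
projective objects shows that `d`-th syzygies have no higher extensions by projective objects. To
exhibit a `d`-th syzygy `M` of `X` as a syzygy of a `d`-th syzygy, embed `X` into an injective
object `I` with cokernel `L` and apply the horseshoe lemma `d` times to `0 ⟶ X ⟶ I ⟶ L ⟶ 0`
(`IsNthSyzygy.exists_isSyzygy`): the syzygy of `I` obtained in this way is projective since `I` has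
projective dimension at most `d`. So all `d`-th syzygies are Gorenstein projective, and every object
has G-dimension at most `d`.

Suppose that all G-dimensions are at most `d`. Dimension shifting gives `Extⁱ(X, R) = 0` for all
`i > d`, all `X` and all projective `R`, which bounds the injective dimension of `R`. Moreover every
`X` embeds into an object `Y` of projective dimension at most `d`
(`GDimensionLE.exists_isSES`); if `X` is injective, it is a direct summand of `Y`.
Finally, if `X` has finite projective dimension `n ≥ 0`, then `Extⁿ(X, -)` is right exact and
nonzero, so it does not vanish on all projective objects, and hence `n ≤ d`
(`ExtProjVanishesAbove.hasProjectiveDimensionLE`).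
-/

namespace GorensteinCat

open Abelian ZeroObject

universe w v u

variable {C : Type u} [Category.{v} C] [Abelian C]

/-! ### Short exact sequences -/

/-- There is a short exact sequence `0 ⟶ A ⟶ B ⟶ D ⟶ 0`. -/
def IsSES (A B D : C) : Prop :=
  ∃ (f : A ⟶ B) (g : B ⟶ D) (h : f ≫ g = 0), (ShortComplex.mk f g h).ShortExact

lemma IsSES.of_iso {A B D A' D' : C} (h : IsSES A B D) (e : A ≅ A') (e' : D ≅ D') :
    IsSES A' B D' := by
  obtain ⟨f, g, w, h⟩ := h
  refine ⟨e.inv ≫ f, g ≫ e'.hom, by simp [reassoc_of% w], ?_⟩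
  exact ShortComplex.shortExact_of_iso
    (ShortComplex.isoMk (S₁ := .mk f g w) (S₂ := .mk _ _ _) e (Iso.refl _) e' (by simp)
      (by simp)) h

lemma isSES_kernel {X Y : C} (p : X ⟶ Y) [Epi p] : IsSES (kernel p) X Y :=
  ⟨kernel.ι p, p, kernel.condition p, { exact := ShortComplex.exact_kernel p }⟩

lemma isSES_cokernel {X Y : C} (i : X ⟶ Y) [Mono i] : IsSES X Y (cokernel i) :=
  ⟨i, cokernel.π i, cokernel.condition i, { exact := ShortComplex.exact_cokernel i }⟩

lemma isSES_zero_left {X Y Z : C} (hZ : IsZero Z) (e : X ≅ Y) : IsSES Z X Y :=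
  ⟨0, e.hom, zero_comp, .mk' ((ShortComplex.exact_iff_mono _ rfl).2 (by dsimp; infer_instance))
    ⟨fun _ _ _ => hZ.eq_of_tgt _ _⟩ (by dsimp; infer_instance)⟩

lemma isSES_zero_right {X Y Z : C} (hZ : IsZero Z) (e : X ≅ Y) : IsSES X Y Z :=
  ⟨e.hom, 0, comp_zero, .mk' ((ShortComplex.exact_iff_epi _ rfl).2 (by dsimp; infer_instance))
    (by dsimp; infer_instance) ⟨fun _ _ _ => hZ.eq_of_src _ _⟩⟩

lemma exact_of_forall_desc {X Y Z : C} {f : X ⟶ Y} {g : Y ⟶ Z} {w : f ≫ g = 0} [Epi g]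
    (h : ∀ (T : C) (k : Y ⟶ T), f ≫ k = 0 → ∃ l, g ≫ l = k) : (ShortComplex.mk f g w).Exact :=
  ShortComplex.exact_of_g_is_cokernel _
    (CokernelCofork.IsColimit.ofπ' _ _ fun {T} k hk => ⟨(h T k hk).choose, (h T k hk).choose_spec⟩)

/-- An exact sequence `X₁ ⟶ X₂ ⟶ X₃` induces a short exact sequence from the cokernel of its first
morphism through `X₃` to the cokernel of its second morphism. -/
lemma isSES_cokernel_of_exact {S : ShortComplex C} (hS : S.Exact) :
    ∃ w, (ShortComplex.mk (cokernel.desc S.f S.g S.zero) (cokernel.π S.g) w).ShortExact := by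
  have := S.exact_iff_mono_cokernel_desc.1 hS
  refine ⟨by ext; simp, .mk' ?_ this (by dsimp; infer_instance)⟩
  refine exact_of_forall_desc fun T k hk => ⟨cokernel.desc S.g k ?_, cokernel.π_desc _ _ _⟩
  rw [← cokernel.π_desc S.f S.g S.zero, Category.assoc, hk, comp_zero]

/-- The snake diagram of a morphism of short exact sequences. -/
noncomputable def snakeInputOfHom {S₁ S₂ : ShortComplex C} (φ : S₁ ⟶ S₂) (h₁ : S₁.ShortExact)
    (h₂ : S₂.ShortExact) : ShortComplex.SnakeInput C where
  L₀ := kernel φ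
  L₁ := S₁
  L₂ := S₂
  L₃ := cokernel φ
  v₀₁ := kernel.ι φ
  v₁₂ := φ
  v₂₃ := cokernel.π φ
  w₀₂ := kernel.condition φ
  w₁₃ := cokernel.condition φ
  h₀ := kernelIsKernel φ
  h₃ := cokernelIsCokernel φ
  L₁_exact := h₁.exact
  L₂_exact := h₂.exact
  epi_L₁_g := h₁.epi_g
  mono_L₂_f := h₂.mono_f

/-- The kernels of a morphism of short exact sequences with epimorphic outer components form a
short exact sequence. -/
lemma isSES_kernels {S₁ S₂ : ShortComplex C} (φ : S₁ ⟶ S₂) (h₁ : S₁.ShortExact)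
    (h₂ : S₂.ShortExact) (hτ₁ : Epi φ.τ₁) {K L : C} {i : K ⟶ S₁.X₁} {j : L ⟶ S₁.X₃}
    {wi : i ≫ φ.τ₁ = 0} {wj : j ≫ φ.τ₃ = 0} (hi : (ShortComplex.mk i φ.τ₁ wi).ShortExact)
    (hj : (ShortComplex.mk j φ.τ₃ wj).ShortExact) : IsSES K (kernel φ.τ₂) L := by
  let D := snakeInputOfHom φ h₁ h₂
  have : Mono D.L₁.f := h₁.mono_f
  have hz : IsZero D.L₃.X₁ := by
    rw [IsZero.iff_id_eq_zero, ← cancel_epi D.v₂₃.τ₁, Category.comp_id, comp_zero]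
    exact (cancel_epi φ.τ₁).1 (D.w₁₃_τ₁.trans comp_zero.symm)
  have he : Epi D.L₀.g :=
    (D.L₁'.exact_iff_epi (hz.eq_zero_of_tgt _)).1 D.L₁'_exact
  have hD : D.L₀.ShortExact := .mk' D.L₀_exact inferInstance he
  let e₁ : D.L₀.X₁ ≅ K := D.h₀τ₁.conePointUniqueUpToIso hi.fIsKernel
  let e₂ : D.L₀.X₂ ≅ kernel φ.τ₂ := D.h₀τ₂.conePointUniqueUpToIso (limit.isLimit _)
  let e₃ : D.L₀.X₃ ≅ L := D.h₀τ₃.conePointUniqueUpToIso hj.fIsKernel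
  exact ⟨e₁.inv ≫ D.L₀.f ≫ e₂.hom, e₂.inv ≫ D.L₀.g ≫ e₃.hom, by simp,
    ShortComplex.shortExact_of_iso (ShortComplex.isoMk e₁ e₂ e₃ (by simp) (by simp)) hD⟩

/-- The cokernels of a morphism of short exact sequences with monomorphic outer components form a
short exact sequence. -/
lemma isSES_cokernels {S₁ S₂ : ShortComplex C} (φ : S₁ ⟶ S₂) (h₁ : S₁.ShortExact)
    (h₂ : S₂.ShortExact) (hτ₃ : Mono φ.τ₃) {K L : C} {p : S₂.X₁ ⟶ K} {q : S₂.X₃ ⟶ L}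
    {wp : φ.τ₁ ≫ p = 0} {wq : φ.τ₃ ≫ q = 0} (hp : (ShortComplex.mk φ.τ₁ p wp).ShortExact)
    (hq : (ShortComplex.mk φ.τ₃ q wq).ShortExact) : IsSES K (cokernel φ.τ₂) L := by
  let D := snakeInputOfHom φ h₁ h₂
  have : Epi D.L₂.g := h₂.epi_g
  have hz : IsZero D.L₀.X₃ := by
    rw [IsZero.iff_id_eq_zero, ← cancel_mono D.v₀₁.τ₃, Category.id_comp, zero_comp]
    exact (cancel_mono φ.τ₃).1 (D.w₀₂_τ₃.trans zero_comp.symm)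
  have hm : Mono D.L₃.f :=
    (D.L₂'.exact_iff_mono (hz.eq_zero_of_src _)).1 D.L₂'_exact
  have hD : D.L₃.ShortExact := .mk' D.L₃_exact hm inferInstance
  let e₁ : D.L₃.X₁ ≅ K := D.h₃τ₁.coconePointUniqueUpToIso hp.gIsCokernel
  let e₂ : D.L₃.X₂ ≅ cokernel φ.τ₂ :=
    D.h₃τ₂.coconePointUniqueUpToIso (colimit.isColimit _)
  let e₃ : D.L₃.X₃ ≅ L := D.h₃τ₃.coconePointUniqueUpToIso hq.gIsCokernel
  exact ⟨e₁.inv ≫ D.L₃.f ≫ e₂.hom, e₂.inv ≫ D.L₃.g ≫ e₃.hom, by simp,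
    ShortComplex.shortExact_of_iso (ShortComplex.isoMk e₁ e₂ e₃ (by simp) (by simp)) hD⟩

/-- The pushout of a short exact sequence along a morphism out of its first term. -/
lemma isSES_of_isPushout {S : ShortComplex C} (hS : S.ShortExact) {A' B' : C} {f : S.X₁ ⟶ A'}
    {a : S.X₂ ⟶ B'} {b : A' ⟶ B'} (h : IsPushout S.f f a b) :
    ∃ (q : B' ⟶ S.X₃) (w : b ≫ q = 0), (ShortComplex.mk b q w).ShortExact := by
  have := hS.mono_f
  have := hS.epi_g
  let q : B' ⟶ S.X₃ := h.desc S.g 0 (by simp)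
  have hq : a ≫ q = S.g := h.inl_desc _ _ _
  have w : b ≫ q = 0 := h.inr_desc _ _ _
  have : Epi q := epi_of_epi_fac hq
  have : Mono b := Abelian.mono_inr_of_isColimit _ _ h.isColimit
  refine ⟨q, w, .mk' (exact_of_forall_desc fun T k hk => ?_) ‹_› ‹_›⟩
  obtain ⟨l, hl⟩ := hS.exact.desc' (a ≫ k) (by rw [h.w_assoc, hk, comp_zero])
  exact ⟨l, h.hom_ext (by rw [← Category.assoc, hq, hl])
    (by rw [← Category.assoc, w, zero_comp, hk])⟩

/-- In the pushout of a monomorphism `i : E ⟶ Q` along the epimorphism of a short exact sequence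
`Y ⟶ E ⟶ X`, the map out of `Q` has kernel `Y`. -/
lemma isSES_of_isPushout_of_epi {S : ShortComplex C} (hS : S.ShortExact) {Q Z : C} {i : S.X₂ ⟶ Q}
    [Mono i] {a : Q ⟶ Z} {b : S.X₃ ⟶ Z} (h : IsPushout i S.g a b) : IsSES S.X₁ Q Z := by
  have := hS.mono_f
  have := hS.epi_g
  have w : (S.f ≫ i) ≫ a = 0 := by rw [Category.assoc, h.w, S.zero_assoc, zero_comp]
  have : Epi a := ⟨fun u v huv => h.hom_ext huv (by
    rw [← cancel_epi S.g, ← h.w_assoc, ← h.w_assoc, huv])⟩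
  refine ⟨S.f ≫ i, a, w, .mk' (exact_of_forall_desc fun T k hk => ?_) (mono_comp _ _) ‹_›⟩
  obtain ⟨l, hl⟩ := hS.exact.desc' (i ≫ k) (by simpa using hk)
  exact ⟨h.desc k l hl.symm, h.inl_desc _ _ _⟩

/-! ### Vanishing of `Ext` into projective objects -/

section Ext

variable [HasExt.{w} C]

/-- `Extⁱ(X, R) = 0` for all projective objects `R` and all `i > n`. -/
def ExtProjVanishesAbove (X : C) (n : ℕ) : Prop :=
  ∀ R : C, Projective R → ∀ i, n < i → ∀ e : Ext X R i, e = 0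

lemma ExtProjVanishesAbove.mono {X : C} {m n : ℕ} (h : ExtProjVanishesAbove X m) (hmn : m ≤ n) :
    ExtProjVanishesAbove X n :=
  fun R hR i hi e => h R hR i (by lia) e

lemma extProjVanishesAbove_of_projective (P : C) [Projective P] : ExtProjVanishesAbove P 0 :=
  fun _ _ _ hi e => e.eq_zero_of_hasProjectiveDimensionLT 1 hi

lemma ExtProjVanishesAbove.middle {A B D : C} {n : ℕ} (h : IsSES A B D)
    (hA : ExtProjVanishesAbove A n) (hD : ExtProjVanishesAbove D n) :
    ExtProjVanishesAbove B n := by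
  obtain ⟨f, g, w, h⟩ := h
  intro R hR i hi e
  obtain ⟨x, rfl⟩ := Ext.contravariant_sequence_exact₂ h R e (hA R hR i hi _)
  rw [hD R hR i hi x, Ext.comp_zero]

lemma ExtProjVanishesAbove.right {A B D : C} {n : ℕ} (h : IsSES A B D)
    (hA : ExtProjVanishesAbove A n) (hB : ExtProjVanishesAbove B (n + 1)) :
    ExtProjVanishesAbove D (n + 1) := by
  obtain ⟨f, g, w, h⟩ := h
  rintro R hR (_ | i) hi e
  · simp at hi
  obtain ⟨x, rfl⟩ := Ext.contravariant_sequence_exact₃ h R e (hB R hR _ hi _) (add_comm 1 i)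
  rw [hA R hR i (by lia) x, Ext.comp_zero]

lemma ExtProjVanishesAbove.left {A B D : C} {n : ℕ} (h : IsSES A B D)
    (hB : ExtProjVanishesAbove B n) (hD : ExtProjVanishesAbove D (n + 1)) :
    ExtProjVanishesAbove A n := by
  obtain ⟨f, g, w, h⟩ := h
  intro R hR i hi e
  obtain ⟨x, rfl⟩ := Ext.contravariant_sequence_exact₁ h R e (add_comm 1 i)
    (hD R hR _ (by lia) _)
  rw [hB R hR i hi x, Ext.comp_zero]

/-- Morphisms to a projective object extend along a monomorphism whose cokernel has no higher
extensions by projective objects. -/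
lemma ExtProjVanishesAbove.exists_extension {S : ShortComplex C} (hS : S.ShortExact)
    (h : ExtProjVanishesAbove S.X₃ 0) {R : C} (hR : Projective R) (f : S.X₁ ⟶ R) :
    ∃ g, S.f ≫ g = f := by
  obtain ⟨x, hx⟩ := Ext.contravariant_sequence_exact₁ hS R (Ext.mk₀ f) (add_zero 1)
    (h R hR 1 one_pos _)
  obtain ⟨g, rfl⟩ := Ext.homEquiv₀.symm.surjective x
  exact ⟨g, Ext.homEquiv₀.symm.injective (by simpa using hx)⟩

lemma ext_one_eq_zero_of_exists_extension {S : ShortComplex C} (hS : S.ShortExact)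
    (hP : Projective S.X₂) {R : C} (h : ∀ f : S.X₁ ⟶ R, ∃ g, S.f ≫ g = f)
    (e : Ext S.X₃ R 1) : e = 0 := by
  obtain ⟨x, rfl⟩ := Ext.contravariant_sequence_exact₃ hS R e
    (Ext.eq_zero_of_hasProjectiveDimensionLT _ 1 le_rfl) (add_zero 1)
  obtain ⟨f, rfl⟩ := Ext.homEquiv₀.symm.surjective x
  obtain ⟨g, rfl⟩ := h f
  simp only [Ext.homEquiv₀_symm_apply]
  rw [← Ext.mk₀_comp_mk₀, hS.extClass_comp_assoc]

/-- In a category with enough projective objects, an object of finite projective dimension without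
extensions by projective objects in degrees `> n` has projective dimension at most `n`: its
`Ext`-functor in the top degree is right exact and vanishes on projective objects. -/
lemma ExtProjVanishesAbove.hasProjectiveDimensionLE [EnoughProjectives C] {X : C} {n m : ℕ}
    (h : ExtProjVanishesAbove X n) (hX : HasProjectiveDimensionLE X (n + m)) :
    HasProjectiveDimensionLE X n := by
  induction m with
  | zero => exact hX
  | succ m ih =>
    refine ih ?_
    rw [HasProjectiveDimensionLE, hasProjectiveDimensionLT_iff]
    intro i hi Y e
    have hS : (ShortComplex.mk _ _ (kernel.condition (Projective.π Y))).ShortExact :=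
      { exact := ShortComplex.exact_kernel _ }
    obtain ⟨x, rfl⟩ := Ext.covariant_sequence_exact₃ X hS e rfl
      (Ext.eq_zero_of_hasProjectiveDimensionLT _ (n + (m + 1) + 1) (by lia))
    rw [h _ (Projective.projective_over Y) i (by lia) x, Ext.zero_comp]

end Ext

/-! ### Syzygies -/

/-- `K` is a first syzygy of `X`: there is a short exact sequence `0 ⟶ K ⟶ P ⟶ X ⟶ 0` with `P`
projective. -/
def IsSyzygy (K X : C) : Prop :=
  ∃ P : C, Projective P ∧ IsSES K P X

lemma IsSyzygy.of_iso {K X K' X' : C} (h : IsSyzygy K X) (e : K ≅ K') (e' : X ≅ X') :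
    IsSyzygy K' X' := by
  obtain ⟨P, hP, h⟩ := h
  exact ⟨P, hP, h.of_iso e e'⟩

lemma exists_isSyzygy [EnoughProjectives C] (X : C) : ∃ K, IsSyzygy K X :=
  ⟨_, _, Projective.projective_over X, isSES_kernel (Projective.π X)⟩

/-- The horseshoe lemma: syzygies of the outer terms of a short exact sequence are the outer terms
of a short exact sequence whose middle term is a syzygy of the given middle term. -/
lemma IsSES.exists_isSyzygy {A B D K L : C} (h : IsSES A B D) (hK : IsSyzygy K A)
    (hL : IsSyzygy L D) : ∃ B', IsSES K B' L ∧ IsSyzygy B' B := by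
  obtain ⟨f, g, w, h⟩ := h
  obtain ⟨P, hP, i, p, wp, hp⟩ := hK
  obtain ⟨Q, hQ, j, q, wq, hq⟩ := hL
  have : Epi g := h.epi_g
  have : Epi p := hp.epi_g
  have : Epi q := hq.epi_g
  let φ : ShortComplex.mk (biprod.inl : P ⟶ P ⊞ Q) biprod.snd (by simp) ⟶ .mk f g w :=
    { τ₁ := p
      τ₂ := biprod.desc (p ≫ f) (Projective.factorThru q g)
      τ₃ := q
      comm₂₃ := by ext <;> simp [w] }
  have h' := (ShortComplex.Splitting.ofHasBinaryBiproduct P Q).shortExact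
  have : Epi φ.τ₂ := by
    have := h'.epi_g
    have : Epi φ.τ₁ := ‹Epi p›
    have : Epi φ.τ₃ := ‹Epi q›
    exact ShortComplex.epi_τ₂_of_exact_of_epi φ h.exact
  exact ⟨kernel φ.τ₂, isSES_kernels φ h' h ‹Epi p› hp hq, P ⊞ Q, inferInstance,
    isSES_kernel φ.τ₂⟩

/-- A dual horseshoe lemma for embeddings into projective objects. In place of injectivity, the
vanishing of `Ext¹` extends the embedding of the first term to the middle term. -/
lemma IsSES.exists_isSyzygy_middle [HasExt.{w} C] {A B D A' D' : C} (h : IsSES A B D)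
    (hA : IsSyzygy A A') (hD : IsSyzygy D D') (hext : ExtProjVanishesAbove D 0) :
    ∃ B', IsSES A' B' D' ∧ IsSyzygy B B' := by
  obtain ⟨f, g, w, h⟩ := h
  obtain ⟨P, hP, i, p, wp, hp⟩ := hA
  obtain ⟨Q, hQ, j, q, wq, hq⟩ := hD
  have : Mono f := h.mono_f
  have : Mono i := hp.mono_f
  have : Mono j := hq.mono_f
  obtain ⟨s, hs⟩ : ∃ s, f ≫ s = i := hext.exists_extension h hP i
  let φ : .mk f g w ⟶ ShortComplex.mk (biprod.inl : P ⟶ P ⊞ Q) biprod.snd (by simp) :=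
    { τ₁ := i
      τ₂ := biprod.lift s (g ≫ j)
      τ₃ := j
      comm₁₂ := by ext <;> simp [hs, reassoc_of% w] }
  have h' := (ShortComplex.Splitting.ofHasBinaryBiproduct P Q).shortExact
  have : Mono φ.τ₂ := by
    have := h'.mono_f
    have : Mono φ.τ₁ := ‹Mono i›
    have : Mono φ.τ₃ := ‹Mono j›
    exact ShortComplex.mono_τ₂_of_exact_of_mono φ h.exact
  exact ⟨cokernel φ.τ₂, isSES_cokernels φ h h' ‹Mono j› hp hq, P ⊞ Q, inferInstance,
    isSES_cokernel φ.τ₂⟩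

/-- `M` is an `n`-th syzygy of `X`: there is an exact sequence
`0 ⟶ M ⟶ Pₙ₋₁ ⟶ ⋯ ⟶ P₀ ⟶ X ⟶ 0` with all `Pᵢ` projective, encoded as a chain of `n` first
syzygies. -/
def IsNthSyzygy : ℕ → C → C → Prop
  | 0, M, X => Nonempty (M ≅ X)
  | n + 1, M, X => ∃ K, IsSyzygy K X ∧ IsNthSyzygy n M K

lemma exists_isNthSyzygy [EnoughProjectives C] (n : ℕ) (X : C) : ∃ M, IsNthSyzygy n M X := by
  induction n generalizing X with
  | zero => exact ⟨X, ⟨Iso.refl X⟩⟩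
  | succ n ih =>
    obtain ⟨K, hK⟩ := exists_isSyzygy X
    obtain ⟨M, hM⟩ := ih K
    exact ⟨M, K, hK, hM⟩

/-- A syzygy of an `n`-th syzygy of `X` is an `n`-th syzygy of a syzygy of `X`. -/
lemma IsNthSyzygy.exists_of_isSyzygy {n : ℕ} {M X K : C} (h : IsNthSyzygy n M X)
    (hK : IsSyzygy K M) : ∃ L, IsSyzygy L X ∧ IsNthSyzygy n K L := by
  induction n generalizing X with
  | zero =>
    obtain ⟨e⟩ := h
    exact ⟨K, hK.of_iso (Iso.refl K) e, ⟨Iso.refl K⟩⟩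
  | succ n ih =>
    obtain ⟨K', hK', h⟩ := h
    exact ⟨K', hK', ih h⟩

lemma IsNthSyzygy.extProjVanishesAbove [HasExt.{w} C] {n m : ℕ} {M X : C}
    (h : IsNthSyzygy n M X) (hX : ExtProjVanishesAbove X (n + m)) :
    ExtProjVanishesAbove M m := by
  induction n generalizing X with
  | zero =>
    obtain ⟨e⟩ := h
    exact .middle (isSES_zero_left (isZero_zero C) e)
      ((extProjVanishesAbove_of_projective 0).mono (by lia)) (hX.mono (by lia))
  | succ n ih =>
    obtain ⟨K, ⟨P, hP, hK⟩, h⟩ := h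
    exact ih h (.left hK ((extProjVanishesAbove_of_projective P).mono (by lia))
      (hX.mono (by lia)))

/-- If the middle term of a short exact sequence has projective dimension at most `n`, then `n`-th
syzygies of the first term are first syzygies of `n`-th syzygies of the last term. -/
lemma IsNthSyzygy.exists_isSyzygy [EnoughProjectives C] {n : ℕ} {M A B D : C}
    (hM : IsNthSyzygy n M A) (h : IsSES A B D) (hB : HasProjectiveDimensionLE B n) :
    ∃ M', IsNthSyzygy n M' D ∧ IsSyzygy M M' := by
  induction n generalizing A B D with
  | zero =>
    obtain ⟨e⟩ := hM
    exact ⟨D, ⟨Iso.refl D⟩, B, projective_iff_hasProjectiveDimensionLE_zero B |>.2 hB,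
      h.of_iso e.symm (Iso.refl D)⟩
  | succ n ih =>
    obtain ⟨K, hK, hM⟩ := hM
    obtain ⟨L, hL⟩ := GorensteinCat.exists_isSyzygy D
    obtain ⟨B', hB', P, hP, _, _, _, hS⟩ := h.exists_isSyzygy hK hL
    obtain ⟨M', hM', hMM'⟩ := ih hM hB'
      ((hS.hasProjectiveDimensionLT_X₃_iff n hP).1 hB)
    exact ⟨M', ⟨L, hL, hM'⟩, hMM'⟩

/-! ### Gorenstein projective objects -/

lemma IsGorensteinProjective.of_iso {X Y : C} (h : IsGorensteinProjective X) (e : X ≅ Y) :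
    IsGorensteinProjective Y := by
  obtain ⟨P, i, hP, ⟨e'⟩⟩ := h
  exact ⟨P, i, hP, ⟨e.symm ≪≫ e'⟩⟩

/-- In a totally acyclic complex the consecutive cokernels are linked by short exact sequences with
projective middle term, along which morphisms to projective objects extend. -/
lemma IsTotallyAcyclic.exists_shortExact {P : ChainComplex C ℤ} (hP : IsTotallyAcyclic P)
    {i j k : ℤ} (hij : j + 1 = i) (hjk : k + 1 = j) :
    ∃ (f : cokernel (P.d i j) ⟶ P.X k) (g : P.X k ⟶ cokernel (P.d j k)) (w : f ≫ g = 0),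
      (ShortComplex.mk f g w).ShortExact ∧
      ∀ (R : C) (_ : Projective R) (a : cokernel (P.d i j) ⟶ R), ∃ b, f ≫ b = a := by
  have hS : (ShortComplex.mk (P.d i j) (P.d j k) (P.d_comp_d i j k)).Exact :=
    (P.exactAt_iff' i j k (by simp [hij]) (by simp [← hjk])).1 (hP.acyclic j)
  obtain ⟨w, h⟩ := isSES_cokernel_of_exact hS
  refine ⟨_, _, w, h, fun R hR a => ?_⟩
  subst hij
  obtain rfl : k = j - 1 := by lia
  obtain ⟨b, hb⟩ := hP.hom_exact R hR j (cokernel.π _ ≫ a) (by simp)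
  exact ⟨b, by ext; simp [hb]⟩

lemma IsGorensteinProjective.exists_isSyzygy_left {X : C} (h : IsGorensteinProjective X) :
    ∃ K, IsGorensteinProjective K ∧ ∃ (P : C) (f : K ⟶ P) (g : P ⟶ X) (w : f ≫ g = 0),
      Projective P ∧ (ShortComplex.mk f g w).ShortExact ∧
      ∀ (R : C) (_ : Projective R) (a : K ⟶ R), ∃ b, f ≫ b = a := by
  obtain ⟨P, i, hP, ⟨e⟩⟩ := h
  obtain ⟨f, g, w, h, hext⟩ := hP.exists_shortExact (i := i + 1 + 1) (j := i + 1) rfl rfl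
  refine ⟨_, ⟨P, i + 1, hP, ⟨Iso.refl _⟩⟩, P.X i, f, g ≫ e.inv, by simp [reassoc_of% w],
    hP.projective i, ?_, hext⟩
  exact ShortComplex.shortExact_of_iso (ShortComplex.isoMk (S₁ := .mk f g w) (S₂ := .mk _ _ _)
    (Iso.refl _) (Iso.refl _) e.symm (by simp) (by simp)) h

lemma IsGorensteinProjective.exists_isSyzygy {X : C} (h : IsGorensteinProjective X) :
    ∃ K, IsGorensteinProjective K ∧ IsSyzygy K X := by
  obtain ⟨K, hK, P, f, g, w, hP, hS, -⟩ := h.exists_isSyzygy_left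
  exact ⟨K, hK, P, hP, f, g, w, hS⟩

lemma IsGorensteinProjective.exists_isSyzygy_right {X : C} (h : IsGorensteinProjective X) :
    ∃ Y, IsGorensteinProjective Y ∧ IsSyzygy X Y := by
  obtain ⟨P, i, hP, ⟨e⟩⟩ := h
  obtain ⟨j, rfl⟩ : ∃ j, i = j + 1 := ⟨i - 1, by lia⟩
  obtain ⟨f, g, w, h, -⟩ := hP.exists_shortExact (i := j + 1 + 1) (k := j) rfl rfl
  exact ⟨_, ⟨P, j, hP, ⟨Iso.refl _⟩⟩, P.X j, hP.projective j,
    .of_iso ⟨f, g, w, h⟩ e.symm (Iso.refl _)⟩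

lemma IsGorensteinProjective.extProjVanishesAbove [HasExt.{w} C] {X : C}
    (h : IsGorensteinProjective X) : ExtProjVanishesAbove X 0 := by
  intro R hR i hi e
  obtain _ | i := i
  · simp at hi
  induction i generalizing X with
  | zero =>
    obtain ⟨K, hK, P, f, g, w, hP, hS, hext⟩ := h.exists_isSyzygy_left
    exact ext_one_eq_zero_of_exists_extension hS hP (hext R hR) e
  | succ i ih =>
    obtain ⟨K, hK, P, f, g, w, hP, hS, hext⟩ := h.exists_isSyzygy_left
    obtain ⟨x, rfl⟩ := Ext.contravariant_sequence_exact₃ hS R e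
      (Ext.eq_zero_of_hasProjectiveDimensionLT _ 1 (by lia)) (add_comm 1 (i + 1))
    rw [ih hK (by lia) x, Ext.comp_zero]

/-- A relation that can be continued in both directions admits bi-infinite chains through any
point. -/
lemma exists_int_chain {α : Type*} (r : α → α → Prop) (hl : ∀ a, ∃ b, r b a)
    (hr : ∀ a, ∃ b, r a b) (a : α) : ∃ M : ℤ → α, M 0 = a ∧ ∀ i, r (M (i + 1)) (M i) := by
  choose l hl using hl
  choose s hs using hr
  refine ⟨fun | .ofNat n => l^[n] a | .negSucc n => s^[n + 1] a, rfl, fun i => ?_⟩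
  obtain n | n | n := i
  · change r (l^[n + 1] a) (l^[n] a)
    rw [Function.iterate_succ_apply']
    exact hl _
  · exact hs a
  · change r (s^[n + 1] a) (s^[n + 1 + 1] a)
    rw [Function.iterate_succ_apply' s (n + 1)]
    exact hs _

/-- Coinduction principle for Gorenstein projectivity: it suffices to find a class of objects
without higher extensions by projective objects in which every object has a syzygy and is a syzygy.
Splicing the resulting short exact sequences yields a totally acyclic complex. -/
theorem isGorensteinProjective_of_class [HasExt.{w} C] (S : C → Prop)
    (hext : ∀ M, S M → ExtProjVanishesAbove M 0)
    (hl : ∀ M, S M → ∃ K, S K ∧ IsSyzygy K M) (hr : ∀ M, S M → ∃ N, S N ∧ IsSyzygy M N)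
    {X : C} (hX : S X) : IsGorensteinProjective X := by
  obtain ⟨M, hM₀, hM⟩ := exists_int_chain (α := Subtype S) (fun a b => IsSyzygy a.1 b.1)
    (fun a => by obtain ⟨K, hK, h⟩ := hl a.1 a.2; exact ⟨⟨K, hK⟩, h⟩)
    (fun a => by obtain ⟨K, hK, h⟩ := hr a.1 a.2; exact ⟨⟨K, hK⟩, h⟩) ⟨X, hX⟩
  choose P hP f g w hS using hM
  have hmono (i : ℤ) : Mono (f i) := (hS i).mono_f
  have hepi (i : ℤ) : Epi (g i) := (hS i).epi_g
  let K : ChainComplex C ℤ := .of P (fun i => g (i + 1) ≫ f i)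
    (fun i => by simp [reassoc_of% (w (i + 1))])
  have hd (i : ℤ) : K.d (i + 1) i = g (i + 1) ≫ f i :=
    ChainComplex.of_d P (fun i => g (i + 1) ≫ f i) i
  have hexact (i : ℤ) : (ShortComplex.mk (K.d (i + 1 + 1) (i + 1)) (K.d (i + 1) i)
      (K.d_comp_d _ _ _)).Exact := by
    have w' : K.d (i + 1 + 1) (i + 1) ≫ g (i + 1) = 0 := by
      rw [hd, Category.assoc]
      exact (congrArg (g (i + 1 + 1) ≫ ·) (w (i + 1))).trans comp_zero
    let φ : ShortComplex.mk _ _ w' ⟶ .mk _ _ (w (i + 1)) :=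
      { τ₁ := g (i + 1 + 1)
        τ₂ := 𝟙 _
        τ₃ := 𝟙 _
        comm₁₂ := (hd (i + 1)).symm.trans (Category.comp_id _).symm }
    let ψ : ShortComplex.mk _ _ w' ⟶ .mk _ _ (K.d_comp_d (i + 1 + 1) (i + 1) i) :=
      { τ₁ := 𝟙 _
        τ₂ := 𝟙 _
        τ₃ := f i
        comm₂₃ := (Category.id_comp _).trans (hd i) }
    have : Epi φ.τ₁ := hepi (i + 1 + 1)
    have : Mono ψ.τ₃ := hmono i
    have : IsIso φ.τ₂ := inferInstanceAs (IsIso (𝟙 _))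
    have : Mono φ.τ₃ := inferInstanceAs (Mono (𝟙 _))
    have : Epi ψ.τ₁ := inferInstanceAs (Epi (𝟙 _))
    have : IsIso ψ.τ₂ := inferInstanceAs (IsIso (𝟙 _))
    exact (ShortComplex.exact_iff_of_epi_of_isIso_of_mono ψ).1
      ((ShortComplex.exact_iff_of_epi_of_isIso_of_mono φ).2 (hS (i + 1)).exact)
  refine ⟨K, 0, ⟨hP, fun j => ?_, fun Q hQ j a ha => ?_⟩, ?_⟩
  · obtain ⟨i, rfl⟩ : ∃ i, j = i + 1 := ⟨j - 1, by lia⟩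
    exact (K.exactAt_iff' (i + 1 + 1) (i + 1) i (by simp) (by simp)).2 (hexact i)
  · obtain ⟨i, rfl⟩ : ∃ i, j = i + 1 := ⟨j - 1, by lia⟩
    obtain ⟨i', hi'⟩ : ∃ i', i' = i + 1 - 1 := ⟨_, rfl⟩
    rw [← hi']
    obtain rfl : i = i' := by lia
    -- `a` vanishes on the image of the incoming differential, so it descends along `g`; the
    -- descended map extends along `f`.
    rw [hd, Category.assoc] at ha
    obtain ⟨b, hb⟩ := (hS (i + 1)).exact.desc' a ((cancel_epi (g (i + 1 + 1))).1
      (ha.trans comp_zero.symm))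
    obtain ⟨c, hc⟩ := ExtProjVanishesAbove.exists_extension (hS i) (hext _ (M i).2) hQ b
    exact ⟨c, by rw [hd, Category.assoc]; exact (congrArg (g (i + 1) ≫ ·) hc).trans hb⟩
  · have e₁ : (M 0).1 ≅ cokernel (f 0) :=
      (hS 0).gIsCokernel.coconePointUniqueUpToIso (colimit.isColimit _)
    have e₂ : cokernel (f 0) ≅ cokernel (g (0 + 1) ≫ f 0) := (cokernelEpiComp _ _).symm
    rw [hM₀] at e₁
    exact ⟨e₁ ≪≫ e₂ ≪≫ cokernelIsoOfEq (hd 0).symm⟩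

lemma isGorensteinProjective_of_projective (P : C) [Projective P] : IsGorensteinProjective P := by
  let := HasExt.standard C
  refine isGorensteinProjective_of_class (fun P : C => Projective P)
    (fun P hP => extProjVanishesAbove_of_projective P)
    (fun P hP => ⟨0, inferInstance, P, hP, isSES_zero_left (isZero_zero C) (Iso.refl P)⟩)
    (fun P hP => ⟨0, inferInstance, P, hP, isSES_zero_right (isZero_zero C) (Iso.refl P)⟩) ‹_›

/-- Gorenstein projective objects are closed under extensions. -/
lemma IsGorensteinProjective.middle {A B D : C} (h : IsSES A B D)
    (hA : IsGorensteinProjective A) (hD : IsGorensteinProjective D) :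
    IsGorensteinProjective B := by
  let := HasExt.standard C
  refine isGorensteinProjective_of_class (fun B : C =>
    ∃ A D, IsGorensteinProjective A ∧ IsGorensteinProjective D ∧ IsSES A B D) ?_ ?_ ?_
    ⟨A, D, hA, hD, h⟩
  · rintro B ⟨A, D, hA, hD, h⟩
    exact .middle h hA.extProjVanishesAbove hD.extProjVanishesAbove
  · rintro B ⟨A, D, hA, hD, h⟩
    obtain ⟨K, hK, hKA⟩ := hA.exists_isSyzygy
    obtain ⟨L, hL, hLD⟩ := hD.exists_isSyzygy
    obtain ⟨B', hB', hBB'⟩ := h.exists_isSyzygy hKA hLD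
    exact ⟨B', ⟨K, L, hK, hL, hB'⟩, hBB'⟩
  · rintro B ⟨A, D, hA, hD, h⟩
    obtain ⟨K, hK, hKA⟩ := hA.exists_isSyzygy_right
    obtain ⟨L, hL, hLD⟩ := hD.exists_isSyzygy_right
    obtain ⟨B', hB', hBB'⟩ := h.exists_isSyzygy_middle hKA hLD hD.extProjVanishesAbove
    exact ⟨B', ⟨K, L, hK, hL, hB'⟩, hBB'⟩

/-! ### G-dimension -/

/-- The G-dimension of `X` is at most `n`, encoded by a chain of short exact sequences
`0 ⟶ Xᵢ₊₁ ⟶ Gᵢ ⟶ Xᵢ ⟶ 0` with `X₀ = X` and all `Gᵢ` and `Xₙ` Gorenstein projective. -/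
def GDimensionLE : ℕ → C → Prop
  | 0, X => IsGorensteinProjective X
  | n + 1, X => ∃ K G, IsGorensteinProjective G ∧ IsSES K G X ∧ GDimensionLE n K

lemma IsNthSyzygy.gDimensionLE {n : ℕ} {M X : C} (h : IsNthSyzygy n M X)
    (hM : IsGorensteinProjective M) : GDimensionLE n X := by
  induction n generalizing X with
  | zero => exact hM.of_iso h.some
  | succ n ih =>
    obtain ⟨K, ⟨P, hP, hK⟩, h⟩ := h
    exact ⟨K, P, isGorensteinProjective_of_projective P, hK, ih h⟩

lemma GDimensionLE.extProjVanishesAbove [HasExt.{w} C] {n : ℕ} {X : C} (h : GDimensionLE n X) :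
    ExtProjVanishesAbove X n := by
  induction n generalizing X with
  | zero => exact IsGorensteinProjective.extProjVanishesAbove h
  | succ n ih =>
    obtain ⟨K, G, hG, hS, hK⟩ := h
    exact .right hS (ih hK) (hG.extProjVanishesAbove.mono (by lia))

/-- An object of finite G-dimension embeds, with Gorenstein projective cokernel, into an object of
finite projective dimension. The cokernel being Gorenstein projective makes the induction work. -/
lemma GDimensionLE.exists_isSES {n : ℕ} {X : C} (h : GDimensionLE n X) :
    ∃ Y G, HasProjectiveDimensionLE Y n ∧ IsGorensteinProjective G ∧ IsSES X Y G := by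
  induction n generalizing X with
  | zero =>
    obtain ⟨G, hG, P, hP, h⟩ := IsGorensteinProjective.exists_isSyzygy_right h
    exact ⟨P, G, projective_iff_hasProjectiveDimensionLE_zero P |>.1 hP, hG, h⟩
  | succ n ih =>
    obtain ⟨K, G, hG, ⟨f, g, w, hS⟩, hK⟩ := h
    obtain ⟨Y, G', hY, hG', ⟨f', g', w', hS'⟩⟩ := ih hK
    -- `E` is the pushout of `G` and `Y` along `K`; it is an extension of `G'` by `G`, and `X` is
    -- its quotient by `Y`.
    have hpo := IsPushout.of_hasPushout f f'
    obtain ⟨q, wq, hq⟩ := isSES_of_isPushout hS hpo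
    obtain ⟨q', wq', hq'⟩ := isSES_of_isPushout hS' hpo.flip
    have hE : IsGorensteinProjective (pushout f f') := hG.middle ⟨_, q', wq', hq'⟩ hG'
    obtain ⟨G'', hG'', P, hP, i, p, wp, hp⟩ := hE.exists_isSyzygy_right
    have : Mono i := hp.mono_f
    have hpo' := IsPushout.of_hasPushout i q
    obtain ⟨r, wr, hr⟩ := isSES_of_isPushout hp hpo'
    obtain ⟨_, _, _, hZ⟩ := isSES_of_isPushout_of_epi hq hpo'
    exact ⟨pushout i q, G'', (hZ.hasProjectiveDimensionLT_X₃_iff n hP).2 hY, hG'', _, r, wr, hr⟩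

lemma HasGPResolutionOfLengthLE.gDimensionLE {n : ℕ} {X : C}
    (h : HasGPResolutionOfLengthLE X n) : GDimensionLE n X := by
  obtain ⟨G, hG, hex, ⟨e⟩, hz⟩ := h
  have key (m j : ℕ) (hj : n ≤ j + m) : GDimensionLE m (cokernel (G.d (j + 1) j)) := by
    induction m generalizing j with
    | zero =>
      have h0 : G.d (j + 1) j = 0 := (hz (j + 1) (by lia)).eq_of_src _ _
      exact (hG j).of_iso (cokernelZeroIsoTarget.symm ≪≫ cokernelIsoOfEq h0.symm)
    | succ m ih =>
      obtain ⟨w, hS⟩ := isSES_cokernel_of_exact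
        ((G.exactAt_iff' (j + 1 + 1) (j + 1) j (by simp) (by simp)).1 (hex (j + 1) (by lia)))
      exact ⟨_, G.X j, hG j, ⟨_, _, w, hS⟩, ih (j + 1) (by lia)⟩
  have h0 := key n 0 (by lia)
  have e' : cokernel (G.d 1 0) ≅ X :=
    (cokernelIsCokernel (G.d 1 0)).coconePointUniqueUpToIso (G.opcyclesIsCokernel 1 0 (by simp)) ≪≫
      (G.isoHomologyι 0 0 (by simp) (by simp)).symm ≪≫ e
  cases n with
  | zero => exact IsGorensteinProjective.of_iso h0 e'
  | succ n =>
    obtain ⟨K, G', hG', hS, hK⟩ := h0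
    exact ⟨K, G', hG', hS.of_iso (Iso.refl K) e', hK⟩

/-- Splicing the short exact sequences gives a resolution. The augmentation to `X` is carried along
in the induction. -/
lemma GDimensionLE.exists_resolution {n : ℕ} {X : C} (h : GDimensionLE n X) :
    ∃ (G : ChainComplex C ℕ) (ε : G.X 0 ⟶ X) (w : G.d 1 0 ≫ ε = 0),
      (∀ i, IsGorensteinProjective (G.X i)) ∧ (∀ i, 0 < i → G.ExactAt i) ∧
      (∀ i, n < i → IsZero (G.X i)) ∧ (ShortComplex.mk _ _ w).Exact ∧ Epi ε := by
  induction n generalizing X with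
  | zero =>
    let Z := HomologicalComplex.single C (ComplexShape.down ℕ) 0
    let e : (Z.obj X).X 0 ≅ X := HomologicalComplex.singleObjXSelf _ 0 X
    have hz (i : ℕ) (hi : 0 < i) : IsZero ((Z.obj X).X i) :=
      HomologicalComplex.isZero_single_obj_X _ _ _ _ hi.ne'
    refine ⟨Z.obj X, e.hom, (hz 1 one_pos).eq_of_src _ _, fun i => ?_, fun i hi => ?_, hz, ?_,
      inferInstance⟩
    · obtain _ | i := i
      · exact IsGorensteinProjective.of_iso h e.symm
      · have := (hz (i + 1) (by lia)).isoZero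
        exact (isGorensteinProjective_of_projective 0).of_iso this.symm
    · exact ShortComplex.exact_of_isZero_X₂ _ (hz i hi)
    · exact (ShortComplex.exact_iff_mono _ ((hz 1 one_pos).eq_of_src _ _)).2
        (by dsimp; infer_instance)
  | succ n ih =>
    obtain ⟨K, G, hG, ⟨f, g, wfg, hS⟩, hK⟩ := h
    obtain ⟨R, ε, w, hR, hex, hz, hε, hepi⟩ := ih hK
    have : Mono f := hS.mono_f
    have w' : R.d 1 0 ≫ ε ≫ f = 0 := by rw [reassoc_of% w, zero_comp]
    have hgf : (ε ≫ f) ≫ g = 0 := by rw [Category.assoc, wfg, comp_zero]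
    refine ⟨R.augment (ε ≫ f) w', g, hgf, fun i => ?_, fun i hi => ?_, fun i hi => ?_, ?_,
      hS.epi_g⟩
    · obtain _ | i := i
      exacts [hG, hR i]
    · obtain _ | _ | i := i
      · simp at hi
      · refine ((R.augment (ε ≫ f) w').exactAt_iff' 2 1 0 (by simp) (by simp)).2 ?_
        let φ : ShortComplex.mk _ _ w ⟶ .mk _ _ w' :=
          { τ₁ := 𝟙 _, τ₂ := 𝟙 _, τ₃ := f }
        have : Epi φ.τ₁ := inferInstanceAs (Epi (𝟙 _))
        have : IsIso φ.τ₂ := inferInstanceAs (IsIso (𝟙 _))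
        have : Mono φ.τ₃ := ‹Mono f›
        exact (ShortComplex.exact_iff_of_epi_of_isIso_of_mono φ).1 hε
      · exact ((R.augment (ε ≫ f) w').exactAt_iff' (i + 3) (i + 2) (i + 1) (by simp)
          (by simp)).2 ((R.exactAt_iff' (i + 2) (i + 1) i (by simp) (by simp)).1
            (hex (i + 1) (by lia)))
    · obtain _ | i := i
      · simp at hi
      · exact hz i (by lia)
    · let φ : ShortComplex.mk _ _ hgf ⟶ .mk _ _ wfg :=
        { τ₁ := ε, τ₂ := 𝟙 _, τ₃ := 𝟙 _ }
      have : Epi φ.τ₁ := hepi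
      have : IsIso φ.τ₂ := inferInstanceAs (IsIso (𝟙 _))
      have : Mono φ.τ₃ := inferInstanceAs (Mono (𝟙 _))
      exact (ShortComplex.exact_iff_of_epi_of_isIso_of_mono φ).2 hS.exact

lemma GDimensionLE.hasGPResolutionOfLengthLE {n : ℕ} {X : C} (h : GDimensionLE n X) :
    HasGPResolutionOfLengthLE X n := by
  obtain ⟨G, ε, w, hG, hex, hz, hε, hepi⟩ := h.exists_resolution
  refine ⟨G, hG, hex, ⟨G.isoHomologyι 0 0 (by simp) (by simp) ≪≫ ?_⟩, hz⟩
  have : Epi (ShortComplex.mk _ _ w).g := hepi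
  exact (G.opcyclesIsCokernel 1 0 (by simp)).coconePointUniqueUpToIso hε.gIsCokernel

lemma gDimension_le_iff {X : C} {n : ℕ} : gDimension X ≤ n ↔ GDimensionLE n X := by
  refine ⟨fun h => ?_, fun h => iInf₂_le_of_le n h.hasGPResolutionOfLengthLE le_rfl⟩
  have h' : gDimension X < ((n + 1 : ℕ) : ℕ∞) :=
    h.trans_lt (Nat.cast_lt.2 n.lt_succ_self)
  simp only [gDimension, iInf_lt_iff] at h'
  obtain ⟨m, ⟨G, hG, hex, he, hz⟩, hm⟩ := h'
  have hm : m < n + 1 := Nat.cast_lt.1 hm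
  exact HasGPResolutionOfLengthLE.gDimensionLE ⟨G, hG, hex, he, fun i hi => hz i (by lia)⟩

/-! ### Gorenstein and Iwanaga–Gorenstein categories -/

/-- In a `d`-Iwanaga–Gorenstein category, `d`-th syzygies are Gorenstein projective. An embedding
of an object into an injective one, whose `d`-th syzygies are projective, embeds its `d`-th syzygies
into projective objects with cokernels that are `d`-th syzygies again. -/
lemma IsIwanagaGorenstein.isGorensteinProjective [EnoughProjectives C] [EnoughInjectives C]
    {d : ℕ} (h : IsIwanagaGorenstein C d) {M X : C} (hM : IsNthSyzygy d M X) :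
    IsGorensteinProjective M := by
  let := HasExt.standard C
  refine isGorensteinProjective_of_class (fun M : C => ∃ X, IsNthSyzygy d M X) ?_ ?_ ?_ ⟨X, hM⟩
  · rintro M ⟨X, hM⟩
    refine hM.extProjVanishesAbove (fun R hR i hi e => ?_)
    have := (injectiveDimension_le_iff R d).1 (h.1 R hR)
    exact e.eq_zero_of_hasInjectiveDimensionLT (d + 1) hi
  · rintro M ⟨X, hM⟩
    obtain ⟨K, hK⟩ := exists_isSyzygy M
    obtain ⟨L, -, hL⟩ := hM.exists_of_isSyzygy hK
    exact ⟨K, ⟨L, hL⟩, hK⟩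
  · rintro M ⟨X, hM⟩
    obtain ⟨N, hN, hMN⟩ := hM.exists_isSyzygy (isSES_cokernel (Injective.ι X))
      ((projectiveDimension_le_iff _ d).1 (h.2 _ inferInstance))
    exact ⟨N, ⟨_, hN⟩, hMN⟩

lemma IsIwanagaGorenstein.isGorenstein [EnoughProjectives C] [EnoughInjectives C] {d : ℕ}
    (h : IsIwanagaGorenstein C d) : IsGorenstein C d := by
  intro X
  obtain ⟨M, hM⟩ := exists_isNthSyzygy d X
  exact gDimension_le_iff.2 (hM.gDimensionLE (h.isGorensteinProjective hM))

lemma IsGorenstein.isIwanagaGorenstein {d : ℕ} (h : IsGorenstein C d) :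
    IsIwanagaGorenstein C d := by
  let := HasExt.standard C
  refine ⟨fun P hP => ?_, fun I hI => ?_⟩
  · rw [injectiveDimension_le_iff, HasInjectiveDimensionLE, hasInjectiveDimensionLT_iff]
    intro i hi X e
    exact (gDimension_le_iff.1 (h X)).extProjVanishesAbove P hP i hi e
  · obtain ⟨Y, G, hY, -, f, g, w, hS⟩ := (gDimension_le_iff.1 (h I)).exists_isSES
    have : Mono f := hS.mono_f
    -- An embedding of an injective object splits.
    have r : Retract I Y := ⟨f, Injective.factorThru (𝟙 I) f, Injective.comp_factorThru _ _⟩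
    exact (projectiveDimension_le_iff I d).2 (r.hasProjectiveDimensionLT (d + 1))

lemma IsGorenstein.finitisticDimension_le [EnoughProjectives C] {d : ℕ} (h : IsGorenstein C d) :
    finitisticDimension C ≤ (d : ℕ∞) := by
  let := HasExt.standard C
  refine iSup₂_le fun X hX => ?_
  obtain ⟨m, hm⟩ := (projectiveDimension_ne_top_iff X).1 hX.ne
  have hd : HasProjectiveDimensionLE X d :=
    (gDimension_le_iff.1 (h X)).extProjVanishesAbove.hasProjectiveDimensionLE (m := m)
      (hasProjectiveDimensionLT_of_ge X (m + 1) _ (by lia))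
  exact WithBot.unbotD_le_iff (by simp) |>.2 ((projectiveDimension_le_iff X d).2 hd)

end GorensteinCat

theorem mainTheorem4 {k : Type*} [Field k] {C : Type*} [Category* C] [Abelian C] [Linear k C]
    (hC : GorensteinCat.IsLFP k C) (d : ℕ) :
    (GorensteinCat.IsIwanagaGorenstein C d ↔ GorensteinCat.IsGorenstein C d) ∧
      (GorensteinCat.IsGorenstein C d → GorensteinCat.finitisticDimension C ≤ (d : ℕ∞)) := by
  have := hC.enoughProjectives
  have := hC.enoughInjectives
  exact ⟨⟨fun h => h.isGorenstein, fun h => h.isIwanagaGorenstein⟩,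
    fun h => h.finitisticDimension_le⟩
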